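/- Let $d\ge 1$, $r,s\ge 0$ be integers with $d=r+2s$. A real polynomial has signature $s$ if, counted with multiplicity, it has exactly $s$ pairs of complex conjugate non-real roots. For $B>0$ let $\mathcal H_d(s,B)$ be the set of vectors $(p_0,\dots,p_d)\in\mathbb R^{d+1}$ with $|p_i|\le B$ for $0\le i\le d$ such that $p_dX^d+\dots+p_1X+p_0$ has signature $s$, and put $$\mathcal H_d^*(s,B)=\{(p_0,\dots,p_{d-1})\in\mathbb R^d:\ (p_0,\dots,p_{d-1},1)\in\mathcal H_d(s,B)\},$$ $$\mathcal H_d^+(s,B)=\{(p_0,\dots,p_d)\in\mathcal H_d(s,B):\ p_d>0\}.$$ Let $H_d(s,B)$ be the set of vectors $(x_1,\dots,x_r,y_1,\dots,y_s,z_1,\dots,z_s)\in\mathbb R^d$ with $z_j\ne 0$ for $1\le j\le s$ and $$-B\le S_j(x_1,\dots,x_r,\,y_1+iz_1,\,y_1-iz_1,\dots,y_s+iz_s,\,y_s-iz_s)\le B\qquad(1\le j\le d),$$ where $S_j$ is the $j$-th elementary symmetric polynomial in $d$ variables. Write $\lambda_n$ for Lebesgue measure on $\mathbb R^n$, $\mathrm{Res}$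 for the resultant, and $R_j(X)=X^2-2y_jX+y_j^2+z_j^2$ for $1\le j\le s$. All the sets and functions occurring below are Lebesgue measurable, and all the volumes and integrals below are finite. (1) For every real $B\ge 1$, $$\lambda_d(\mathcal H_d^*(s,B))=\frac{2^s}{r!\,s!}\int_{H_d(s,B)}|\Delta_r|\,\Delta_s\,\Delta_{r,s}\prod_{j=1}^{s}|z_j|\;dx_1\cdots dx_r\,dy_1\,dz_1\cdots dy_s\,dz_s,$$ where $$\Delta_r=\prod_{1\le j<k\le r}(x_j-x_k),\qquad \Delta_s=\prod_{1\le j<k\le s}\mathrm{Res}(R_j(X),R_k(X)),\qquad \Delta_{r,s}=\prod_{j=1}^{r}\prod_{k=1}^{s}R_k(x_j).$$ (2) For every real $B>0$, $$\lambda_{d+1}(\mathcal H_d^+(s,B))=B^{d+1}\int_0^1u^d\,\lambda_d\!\left(\mathcal H_d^*\!\left(s,\tfrac1u\right)\right)du.$$ -/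

import Mathlib

open MeasureTheory Polynomial

noncomputable section

namespace BoundedHeight

/-- The polynomial `p_0 + p_1 X + ⋯ + p_d X^d` with coefficient vector `p = (p_0, …, p_d)`. -/
def toPoly {d : ℕ} (p : Fin (d + 1) → ℝ) : ℝ[X] :=
  ∑ i : Fin (d + 1), C (p i) * X ^ (i : ℕ)

/-- `P` has signature `s`: counted with multiplicity, `P` has exactly `2 s` non-real complex roots
(that is, `s` pairs of complex conjugate ones). -/
def HasSignature (P : ℝ[X]) (s : ℕ) : Prop :=
  Multiset.card ((P.aroots ℂ).filter fun w => w.im ≠ 0) = 2 * s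

/-- The set `𝓗_d(s, B)` of the vectors `(p_0, …, p_d)` with `|p_i| ≤ B` for all `i` whose
polynomial has signature `s`. -/
def coeffSet (d s : ℕ) (B : ℝ) : Set (Fin (d + 1) → ℝ) :=
  {p | (∀ i, |p i| ≤ B) ∧ HasSignature (toPoly p) s}

/-- The set `𝓗_d^*(s, B)` of the vectors `(p_0, …, p_{d-1})` such that
`(p_0, …, p_{d-1}, 1)` lies in `𝓗_d(s, B)`. -/
def coeffSetMonic (d s : ℕ) (B : ℝ) : Set (Fin d → ℝ) :=
  {p | (Fin.snoc p 1 : Fin (d + 1) → ℝ) ∈ coeffSet d s B}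

/-- The set `𝓗_d^+(s, B)` of the vectors in `𝓗_d(s, B)` with `p_d > 0`. -/
def coeffSetPos (d s : ℕ) (B : ℝ) : Set (Fin (d + 1) → ℝ) :=
  {p | p ∈ coeffSet d s B ∧ 0 < p (Fin.last d)}

/-- The space `ℝ^r × ℝ^s × ℝ^s` of the root coordinates
`(x_1, …, x_r, y_1, …, y_s, z_1, …, z_s)`, with its Lebesgue measure. -/
abbrev RootCoords (r s : ℕ) : Type := (Fin r → ℝ) × (Fin s → ℝ) × (Fin s → ℝ)

/-- The `r + 2 s` complex numbers `x_1, …, x_r, y_1 ± i z_1, …, y_s ± i z_s`. -/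
def rootFamily {r s : ℕ} (v : RootCoords r s) : Multiset ℂ :=
  (Finset.univ.val.map fun j : Fin r => (v.1 j : ℂ)) +
  ((Finset.univ.val.map fun j : Fin s => (v.2.1 j : ℂ) + v.2.2 j * Complex.I) +
   (Finset.univ.val.map fun j : Fin s => (v.2.1 j : ℂ) - v.2.2 j * Complex.I))

/-- The set `H_d(s, B)`, `d = r + 2 s`: all elementary symmetric functions `S_1, …, S_d` of the
numbers `x_j`, `y_j ± i z_j` are real numbers in `[-B, B]`, and `z_j ≠ 0` for all `j`. -/
def rootSet (r s : ℕ) (B : ℝ) : Set (RootCoords r s) :=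
  {v | (∀ j ∈ Finset.Icc 1 (r + 2 * s),
          ∃ c : ℝ, -B ≤ c ∧ c ≤ B ∧ (rootFamily v).esymm j = (c : ℂ)) ∧
       ∀ j, v.2.2 j ≠ 0}

/-- The quadratic polynomial `R = X^2 - 2 y X + y^2 + z^2` with roots `y ± i z`. -/
def quadFactor (y z : ℝ) : ℝ[X] := X ^ 2 - C (2 * y) * X + C (y ^ 2 + z ^ 2)

/-- `Δ_r = ∏_{j < k} (x_j - x_k)`. -/
def deltaReal {r s : ℕ} (v : RootCoords r s) : ℝ :=
  ∏ j : Fin r, ∏ k ∈ Finset.Ioi j, (v.1 j - v.1 k)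

/-- `Δ_s = ∏_{j < k} Res(R_j, R_k)`. -/
def deltaQuad {r s : ℕ} (v : RootCoords r s) : ℝ :=
  ∏ j : Fin s, ∏ k ∈ Finset.Ioi j,
    (quadFactor (v.2.1 j) (v.2.2 j)).resultant (quadFactor (v.2.1 k) (v.2.2 k))

/-- `Δ_{r,s} = ∏_j ∏_k R_k(x_j)`. -/
def deltaMixed {r s : ℕ} (v : RootCoords r s) : ℝ :=
  ∏ j : Fin r, ∏ k : Fin s, (quadFactor (v.2.1 k) (v.2.2 k)).eval (v.1 j)

/-- The integrand `|Δ_r| Δ_s Δ_{r,s} ∏_j |z_j|`. -/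
def rootWeight {r s : ℕ} (v : RootCoords r s) : ℝ :=
  |deltaReal v| * deltaQuad v * deltaMixed v * ∏ j : Fin s, |v.2.2 j|

end BoundedHeight

end

/-!
Writing a polynomial of signature `s` through its real roots `x` and its pairs of roots `y ± i z`
gives a map from root coordinates to coefficients. Almost every fibre is an orbit of the group that
permutes the real roots, permutes the pairs and changes the signs of the `z`, so the map is
`2 ^ s * r! * s!` to one, and injective on ordered roots. Its Jacobian is the absolute Vandermonde
determinant of all the roots, which is `2 ^ s` times the weight of the theorem, times a further
`2 ^ s` from the substitution `(y, z) ↦ (y + i z, y - i z)`; this leaves the constant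
`4 ^ s / (2 ^ s * r! * s!)`. Part (1) is then the change of variables formula, and part (2) is
Fubini over the leading coefficient `u`, each slice being a multiple of a set of monic polynomials.
-/

open scoped ComplexConjugate Pointwise ENNReal

noncomputable section

namespace BoundedHeight

section AbsDiscr

variable {𝕜 ι κ : Type*} [NormedField 𝕜] [Fintype ι] [DecidableEq ι] [Fintype κ] [DecidableEq κ]

/-- The absolute value of the discriminant of the monic polynomial with roots `w i`, as the product
of the distances over all ordered pairs of distinct indices. -/
def absDiscr (w : ι → 𝕜) : ℝ := ∏ i, ∏ j ∈ {i}ᶜ, ‖w i - w j‖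

lemma absDiscr_pos {w : ι → 𝕜} (hw : Function.Injective w) : 0 < absDiscr w :=
  Finset.prod_pos fun i _ => Finset.prod_pos fun j hj =>
    norm_pos_iff.mpr <| sub_ne_zero.mpr <| hw.ne fun h => by simp [h] at hj

lemma absDiscr_comp_equiv (w : ι → 𝕜) (e : κ ≃ ι) : absDiscr (w ∘ e) = absDiscr w := by
  unfold absDiscr
  rw [← e.prod_comp]
  refine Finset.prod_congr rfl fun i _ => ?_
  refine Finset.prod_equiv e (fun j => ?_) fun j _ => rfl
  simp

lemma absDiscr_conj (w : ι → ℂ) : absDiscr (fun i => conj (w i)) = absDiscr w := by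
  simp only [absDiscr, ← map_sub, Complex.norm_conj]

lemma absDiscr_ofReal (x : ι → ℝ) : absDiscr (fun i => (x i : ℂ)) = absDiscr x := by
  simp only [absDiscr, ← Complex.ofReal_sub, Complex.norm_real]

lemma absDiscr_sumElim (f : ι → 𝕜) (g : κ → 𝕜) :
    absDiscr (Sum.elim f g) = absDiscr f * (∏ i, ∏ j, ‖f i - g j‖) ^ 2 * absDiscr g := by
  have hl (i : ι) : ({Sum.inl i}ᶜ : Finset (ι ⊕ κ)) = ({i}ᶜ : Finset ι).disjSum Finset.univ := by
    ext (j | j) <;> simp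
  have hr (i : κ) : ({Sum.inr i}ᶜ : Finset (ι ⊕ κ)) = Finset.univ.disjSum ({i}ᶜ : Finset κ) := by
    ext (j | j) <;> simp
  have hswap : ∏ i, ∏ j, ‖g i - f j‖ = ∏ i, ∏ j, ‖f i - g j‖ := by
    rw [Finset.prod_comm]
    simp only [norm_sub_rev]
  simp only [absDiscr, Fintype.prod_sum_type, hl, hr, Finset.prod_disjSum, Sum.elim_inl,
    Sum.elim_inr, Finset.prod_mul_distrib, hswap]
  ring

end AbsDiscr

section Ordered

variable {ι : Type*} [Fintype ι] [LinearOrder ι] [LocallyFiniteOrderTop ι]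
  [LocallyFiniteOrderBot ι]

lemma prod_prod_compl_eq_prod_prod_Ioi_sq {f : ι → ι → ℝ} (hf : ∀ i j, f i j = f j i) :
    ∏ i, ∏ j ∈ {i}ᶜ, f i j = (∏ i, ∏ j ∈ Finset.Ioi i, f i j) ^ 2 := by
  have h := Finset.prod_prod_Ioi_mul_eq_prod_prod_off_diag f
  simp only [hf, ← sq, Finset.prod_pow] at h
  exact h.symm

lemma absDiscr_eq_sq {𝕜 : Type*} [NormedField 𝕜] (w : ι → 𝕜) :
    absDiscr w = (∏ i, ∏ j ∈ Finset.Ioi i, ‖w i - w j‖) ^ 2 :=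
  prod_prod_compl_eq_prod_prod_Ioi_sq fun i j => norm_sub_rev (w i) (w j)

lemma absDiscr_sumElim_conj (a : ι → ℂ) :
    absDiscr (Sum.elim a fun j => conj (a j)) =
      ((∏ j, ‖a j - conj (a j)‖) *
        ∏ j, ∏ k ∈ Finset.Ioi j, (‖a j - a k‖ * ‖a j - conj (a k)‖) ^ 2) ^ 2 := by
  have hsymm (j k : ι) : ‖a j - conj (a k)‖ = ‖a k - conj (a j)‖ := by
    rw [← Complex.norm_conj, map_sub, Complex.conj_conj, norm_sub_rev]
  have hoff : ∏ j, ∏ k, ‖a j - conj (a k)‖ =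
      (∏ j, ‖a j - conj (a j)‖) * (∏ j, ∏ k ∈ Finset.Ioi j, ‖a j - conj (a k)‖) ^ 2 := by
    rw [← prod_prod_compl_eq_prod_prod_Ioi_sq hsymm, ← Finset.prod_mul_distrib]
    exact Finset.prod_congr rfl fun j _ => Fintype.prod_eq_mul_prod_compl j _
  rw [absDiscr_sumElim, absDiscr_conj, absDiscr_eq_sq, hoff]
  simp only [Finset.prod_pow, Finset.prod_mul_distrib]
  ring

end Ordered

lemma norm_det_vandermonde {𝕜 : Type*} [NormedField 𝕜] {n : ℕ} (w : Fin n → 𝕜) :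
    ‖(Matrix.vandermonde w).det‖ = √(absDiscr w) := by
  have h : absDiscr w = ‖(Matrix.vandermonde w).det‖ ^ 2 := by
    simp only [Matrix.det_vandermonde, norm_prod, absDiscr_eq_sq, norm_sub_rev]
  rw [h, Real.sqrt_sq (norm_nonneg _)]

/-- The complex number `y_j + i z_j`. -/
def upperRoot {r s : ℕ} (v : RootCoords r s) (j : Fin s) : ℂ := ⟨v.2.1 j, v.2.2 j⟩

/-- The index type of the roots: `r` real ones and `s` pairs of complex conjugate ones. -/
abbrev RootIdx (r s : ℕ) : Type := Fin r ⊕ (Fin s ⊕ Fin s)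

/-- The roots `x_j`, `y_j + i z_j`, `y_j - i z_j` as an indexed family. -/
def rootVec {r s : ℕ} (v : RootCoords r s) : RootIdx r s → ℂ :=
  Sum.elim (fun j => (v.1 j : ℂ)) (Sum.elim (upperRoot v) fun j => conj (upperRoot v j))

lemma map_quadFactor (a : ℂ) :
    (quadFactor a.re a.im).map (algebraMap ℝ ℂ) = (X - C a) * (X - C (conj a)) := by
  have hadd : C a + C (conj a) = C ((2 * a.re : ℝ) : ℂ) := by rw [← C_add, Complex.add_conj]
  have hmul : C a * C (conj a) = C ((a.re ^ 2 + a.im ^ 2 : ℝ) : ℂ) := by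
    rw [← C_mul, Complex.mul_conj, Complex.normSq_apply, sq, sq]
  simp only [quadFactor, Polynomial.map_add, Polynomial.map_sub, Polynomial.map_mul,
    Polynomial.map_pow, map_X, map_C, Complex.coe_algebraMap, ← hadd, ← hmul]
  ring

lemma eval_quadFactor (a : ℂ) (x : ℝ) : (quadFactor a.re a.im).eval x = ‖(x : ℂ) - a‖ ^ 2 := by
  simp [quadFactor, Complex.sq_norm, Complex.normSq_apply]
  ring

lemma natDegree_quadFactor (y z : ℝ) : (quadFactor y z).natDegree = 2 := by
  unfold quadFactor
  compute_degree!

lemma resultant_quadFactor (a b : ℂ) :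
    (quadFactor a.re a.im).resultant (quadFactor b.re b.im) =
      (‖a - b‖ * ‖a - conj b‖) ^ 2 := by
  have hdeg : ((quadFactor b.re b.im).map (algebraMap ℝ ℂ)).natDegree ≤ 2 :=
    natDegree_map_le.trans (natDegree_quadFactor _ _).le
  apply Complex.ofReal_injective
  calc (((quadFactor a.re a.im).resultant (quadFactor b.re b.im) : ℝ) : ℂ)
    _ = ((X - C a) * (X - C (conj a))).resultant ((quadFactor b.re b.im).map (algebraMap ℝ ℂ))
          ((X - C a).natDegree + (X - C (conj a)).natDegree) 2 := by
        rw [← map_quadFactor, resultant_map_map, natDegree_X_sub_C, natDegree_X_sub_C,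
          natDegree_quadFactor, natDegree_quadFactor]
        rfl
    _ = (a - b) * (a - conj b) * ((conj a - b) * (conj a - conj b)) := by
        rw [resultant_mul_left _ _ _ _ hdeg, natDegree_X_sub_C, natDegree_X_sub_C,
          resultant_X_sub_C_left _ _ _ hdeg, resultant_X_sub_C_left _ _ _ hdeg, map_quadFactor]
        simp
    _ = (a - b) * conj (a - b) * ((a - conj b) * conj (a - conj b)) := by
        simp only [map_sub, Complex.conj_conj]
        ring
    _ = ((‖a - b‖ * ‖a - conj b‖) ^ 2 : ℝ) := by
        simp only [Complex.mul_conj, Complex.normSq_eq_norm_sq]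
        push_cast
        ring

lemma absDiscr_rootVec {r s : ℕ} (v : RootCoords r s) :
    absDiscr (rootVec v) = (2 ^ s * rootWeight v) ^ 2 := by
  have hreal : absDiscr (fun j => (v.1 j : ℂ)) = |deltaReal v| ^ 2 := by
    rw [absDiscr_ofReal, absDiscr_eq_sq]
    simp only [deltaReal, Finset.abs_prod, Real.norm_eq_abs]
  have hmixed : ∏ i, ∏ k, ‖(v.1 i : ℂ) - Sum.elim (upperRoot v) (fun j => conj (upperRoot v j)) k‖
      = deltaMixed v := by
    simp only [deltaMixed, Fintype.prod_sum_type, Sum.elim_inl, Sum.elim_inr,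
      ← Finset.prod_mul_distrib]
    refine Finset.prod_congr rfl fun i _ => Finset.prod_congr rfl fun j _ => ?_
    rw [← Complex.norm_conj (v.1 i - conj (upperRoot v j)), map_sub, Complex.conj_conj,
      Complex.conj_ofReal, ← sq]
    exact (eval_quadFactor (upperRoot v j) (v.1 i)).symm
  have hquad : ∏ j, ∏ k ∈ Finset.Ioi j, (‖upperRoot v j - upperRoot v k‖ *
      ‖upperRoot v j - conj (upperRoot v k)‖) ^ 2 = deltaQuad v := by
    simp only [← resultant_quadFactor]
    rfl
  have himag : ∏ j, ‖upperRoot v j - conj (upperRoot v j)‖ = 2 ^ s * ∏ j, |v.2.2 j| := by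
    simp [Complex.sub_conj, Finset.prod_mul_distrib, upperRoot]
  rw [rootVec, absDiscr_sumElim, absDiscr_sumElim_conj, hreal, hmixed, hquad, himag, rootWeight]
  ring

lemma rootWeight_nonneg {r s : ℕ} (v : RootCoords r s) : 0 ≤ rootWeight v := by
  have hquad : 0 ≤ deltaQuad v := Finset.prod_nonneg fun j _ => Finset.prod_nonneg fun k _ =>
    (sq_nonneg _).trans_eq (resultant_quadFactor (upperRoot v j) (upperRoot v k)).symm
  have hmixed : 0 ≤ deltaMixed v := Finset.prod_nonneg fun j _ => Finset.prod_nonneg fun k _ =>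
    (sq_nonneg _).trans_eq (eval_quadFactor (upperRoot v k) (v.1 j)).symm
  unfold rootWeight
  positivity

lemma sqrt_absDiscr_rootVec {r s : ℕ} (v : RootCoords r s) :
    √(absDiscr (rootVec v)) = 2 ^ s * rootWeight v := by
  rw [absDiscr_rootVec, Real.sqrt_sq (mul_nonneg (by positivity) (rootWeight_nonneg v))]

/-- The root family as a linear function of the root coordinates. -/
def rootVecCLM (r s : ℕ) : RootCoords r s →L[ℝ] (RootIdx r s → ℂ) :=
  LinearMap.toContinuousLinearMap
    { toFun := rootVec
      map_add' := fun v w => by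
        ext (j | j | j) <;> simp [rootVec, upperRoot, Complex.ext_iff, add_comm]
      map_smul' := fun t v => by
        ext (j | j | j) <;> simp [rootVec, upperRoot, Complex.ext_iff] }

lemma continuous_rootVec (r s : ℕ) : Continuous (rootVec : RootCoords r s → RootIdx r s → ℂ) :=
  (rootVecCLM r s).continuous

lemma continuous_rootWeight (r s : ℕ) : Continuous (rootWeight : RootCoords r s → ℝ) := by
  have h : (rootWeight : RootCoords r s → ℝ) = fun v => √(absDiscr (rootVec v)) / 2 ^ s := by
    ext v
    rw [sqrt_absDiscr_rootVec, mul_div_cancel_left₀ _ (by positivity)]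
  have := continuous_rootVec r s
  rw [h]
  unfold absDiscr
  fun_prop

section ToPoly

variable {d : ℕ}

lemma coeff_toPoly (p : Fin (d + 1) → ℝ) (i : Fin (d + 1)) : (toPoly p).coeff i = p i := by
  simp [toPoly, coeff_C_mul, coeff_X_pow, Fin.val_inj]

lemma natDegree_toPoly_le (p : Fin (d + 1) → ℝ) : (toPoly p).natDegree ≤ d :=
  natDegree_sum_le_of_forall_le _ _ fun i _ =>
    (natDegree_C_mul_X_pow_le _ _).trans (Nat.lt_succ_iff.mp i.2)

lemma toPoly_smul (t : ℝ) (p : Fin (d + 1) → ℝ) : toPoly (t • p) = C t * toPoly p := by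
  simp [toPoly, Finset.mul_sum, mul_assoc]

lemma coeff_toPoly_snoc_castSucc (q : Fin d → ℝ) (t : ℝ) (i : Fin d) :
    (toPoly (Fin.snoc q t : Fin (d + 1) → ℝ)).coeff i = q i := by
  simpa using coeff_toPoly (Fin.snoc q t : Fin (d + 1) → ℝ) i.castSucc

lemma coeff_toPoly_snoc_last (q : Fin d → ℝ) (t : ℝ) :
    (toPoly (Fin.snoc q t : Fin (d + 1) → ℝ)).coeff d = t := by
  simpa using coeff_toPoly (Fin.snoc q t : Fin (d + 1) → ℝ) (Fin.last d)

lemma natDegree_toPoly_snoc_one (q : Fin d → ℝ) :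
    (toPoly (Fin.snoc q 1 : Fin (d + 1) → ℝ)).natDegree = d :=
  natDegree_eq_of_le_of_coeff_ne_zero (natDegree_toPoly_le _) <| by
    rw [coeff_toPoly_snoc_last]
    exact one_ne_zero

lemma monic_toPoly_snoc_one (q : Fin d → ℝ) : (toPoly (Fin.snoc q 1 : Fin (d + 1) → ℝ)).Monic := by
  rw [Monic, leadingCoeff, natDegree_toPoly_snoc_one, coeff_toPoly_snoc_last]

lemma toPoly_snoc_coeff {P : ℝ[X]} (hP : P.Monic) (hd : P.natDegree = d) :
    toPoly (Fin.snoc (fun i : Fin d => P.coeff i) 1 : Fin (d + 1) → ℝ) = P := by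
  refine (ext_iff_natDegree_le (natDegree_toPoly_le _) hd.le).mpr fun n hn => ?_
  rcases hn.lt_or_eq with hn | rfl
  · exact coeff_toPoly_snoc_castSucc _ _ ⟨n, hn⟩
  · rw [coeff_toPoly_snoc_last, ← hd, hP.coeff_natDegree]

end ToPoly

section ConjStable

lemma aroots_map_conj (P : ℝ[X]) : (P.aroots ℂ).map conj = P.aroots ℂ := by
  have h : (P.map (algebraMap ℝ ℂ)).map (starRingEnd ℂ) = P.map (algebraMap ℝ ℂ) := by
    rw [Polynomial.map_map]
    congr 1
    ext x
    simp
  rw [aroots_def, ← (IsAlgClosed.splits (P.map (algebraMap ℝ ℂ))).roots_map, h]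

lemma eq_of_aroots_eq {P Q : ℝ[X]} (hP : P.Monic) (hQ : Q.Monic)
    (h : P.aroots ℂ = Q.aroots ℂ) : P = Q := by
  apply map_injective (algebraMap ℝ ℂ) (algebraMap ℝ ℂ).injective
  rw [(IsAlgClosed.splits _).eq_prod_roots_of_monic (hP.map _),
    (IsAlgClosed.splits _).eq_prod_roots_of_monic (hQ.map _), ← aroots_def, h, aroots_def]

lemma filter_im_ne_zero_eq_add_map_conj {m : Multiset ℂ} (hm : m.map conj = m) :
    m.filter (fun w => w.im ≠ 0) =
      m.filter (fun w => 0 < w.im) + (m.filter fun w => 0 < w.im).map conj := by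
  have hneg : (m.filter fun w => 0 < w.im).map conj = m.filter (fun w => w.im < 0) := by
    conv_rhs => rw [← hm, Multiset.filter_map]
    simp only [Function.comp_def, Complex.conj_im, neg_lt_zero]
  rw [hneg, Multiset.filter_add_filter,
    Multiset.filter_eq_nil.mpr fun (w : ℂ) _ (h : 0 < w.im ∧ w.im < 0) => lt_asymm h.1 h.2,
    add_zero]
  exact Multiset.filter_congr fun w _ => ne_iff_lt_or_gt.trans or_comm

lemma exists_map_univ_eq {α : Type*} {n : ℕ} {m : Multiset α} (h : Multiset.card m = n) :
    ∃ f : Fin n → α, Finset.univ.val.map f = m := by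
  subst h
  obtain ⟨l, rfl⟩ := Quot.exists_rep m
  exact ⟨l.get, (Fin.univ_val_map _).trans (congrArg _ (List.ofFn_get l))⟩

end ConjStable

section RootsAndCoefficients

variable {r s : ℕ}

lemma rootFamily_eq_add (v : RootCoords r s) :
    rootFamily v = Finset.univ.val.map (fun j => (v.1 j : ℂ)) +
      (Finset.univ.val.map (upperRoot v) +
        Finset.univ.val.map fun j => conj (upperRoot v j)) := by
  have h (j : Fin s) : (v.2.1 j : ℂ) + v.2.2 j * Complex.I = upperRoot v j := by
    simp [upperRoot, Complex.ext_iff]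
  have hconj (j : Fin s) : (v.2.1 j : ℂ) - v.2.2 j * Complex.I = conj (upperRoot v j) := by
    simp [upperRoot, Complex.ext_iff]
  simp only [rootFamily, h, hconj]

lemma rootFamily_eq_map (v : RootCoords r s) :
    rootFamily v = Finset.univ.val.map (rootVec v) := by
  simp only [rootFamily_eq_add, ← Finset.univ_disjSum_univ, Finset.val_disjSum,
    Multiset.disjSum, Multiset.map_add, Multiset.map_map]
  rfl

lemma card_rootFamily (v : RootCoords r s) : Multiset.card (rootFamily v) = r + 2 * s := by
  simp [rootFamily, two_mul]

lemma exists_rootFamily_eq {m : Multiset ℂ} (hcard : Multiset.card m = r + 2 * s)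
    (hconj : m.map conj = m) (hnonreal : Multiset.card (m.filter fun w => w.im ≠ 0) = 2 * s) :
    ∃ v : RootCoords r s, rootFamily v = m := by
  have hsplit := filter_im_ne_zero_eq_add_map_conj hconj
  have hpos : Multiset.card (m.filter fun w => 0 < w.im) = s := by
    rw [hsplit, Multiset.card_add, Multiset.card_map] at hnonreal
    lia
  have hadd := Multiset.filter_add_not (fun w : ℂ => w.im ≠ 0) m
  have hreal : Multiset.card (m.filter fun w => ¬ w.im ≠ 0) = r := by
    have := congrArg Multiset.card hadd
    rw [Multiset.card_add] at this
    lia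
  obtain ⟨f, hf⟩ := exists_map_univ_eq hreal
  obtain ⟨a, ha⟩ := exists_map_univ_eq hpos
  have hf_im (j : Fin r) : (f j).im = 0 := by
    have hmem : f j ∈ m.filter (fun w => ¬ w.im ≠ 0) :=
      hf ▸ Multiset.mem_map_of_mem f (Finset.mem_univ j)
    exact not_not.mp (Multiset.mem_filter.mp hmem).2
  have hf_re : (fun j => ((f j).re : ℂ)) = f := by
    ext j
    exact Complex.ext rfl (hf_im j).symm
  refine ⟨(fun j => (f j).re, fun j => (a j).re, fun j => (a j).im), ?_⟩
  rw [← hadd, hsplit, ← ha, ← hf, add_comm, Multiset.map_map, rootFamily_eq_add, hf_re]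
  rfl

/-- The real monic polynomial `∏_j (X - x_j) ∏_j R_j` with root coordinates `v`. -/
def rootPoly (v : RootCoords r s) : ℝ[X] :=
  (∏ j, (X - C (v.1 j))) * ∏ j, quadFactor (v.2.1 j) (v.2.2 j)

/-- The non-leading coefficients of the monic polynomial with root coordinates `v`. -/
def coeffMap (v : RootCoords r s) : Fin (r + 2 * s) → ℝ := fun i => (rootPoly v).coeff i

lemma map_rootPoly (v : RootCoords r s) :
    (rootPoly v).map (algebraMap ℝ ℂ) = ∏ k, (X - C (rootVec v k)) := by
  have hquad (j : Fin s) : (quadFactor (v.2.1 j) (v.2.2 j)).map (algebraMap ℝ ℂ) =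
      (X - C (upperRoot v j)) * (X - C (conj (upperRoot v j))) := map_quadFactor (upperRoot v j)
  simp [rootPoly, Polynomial.map_prod, hquad, rootVec, Finset.prod_mul_distrib]

lemma map_rootPoly_eq_prod_rootFamily (v : RootCoords r s) :
    (rootPoly v).map (algebraMap ℝ ℂ) = ((rootFamily v).map fun w => X - C w).prod := by
  rw [map_rootPoly, rootFamily_eq_map, Multiset.map_map]
  rfl

lemma aroots_rootPoly (v : RootCoords r s) : (rootPoly v).aroots ℂ = rootFamily v := by
  rw [aroots_def, map_rootPoly_eq_prod_rootFamily, roots_multiset_prod_X_sub_C]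

lemma monic_rootPoly (v : RootCoords r s) : (rootPoly v).Monic :=
  monic_of_injective (algebraMap ℝ ℂ).injective <| by
    rw [map_rootPoly]
    exact monic_prod_X_sub_C _ _

lemma natDegree_rootPoly (v : RootCoords r s) : (rootPoly v).natDegree = r + 2 * s := by
  rw [← natDegree_map (algebraMap ℝ ℂ), map_rootPoly_eq_prod_rootFamily,
    natDegree_multiset_prod_X_sub_C_eq_card, card_rootFamily]

lemma toPoly_snoc_coeffMap (v : RootCoords r s) :
    toPoly (Fin.snoc (coeffMap v) 1 : Fin (r + 2 * s + 1) → ℝ) = rootPoly v :=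
  toPoly_snoc_coeff (monic_rootPoly v) (natDegree_rootPoly v)

lemma rootFamily_eq_of_coeffMap_eq {v w : RootCoords r s} (h : coeffMap v = coeffMap w) :
    rootFamily v = rootFamily w := by
  rw [← aroots_rootPoly, ← aroots_rootPoly, ← toPoly_snoc_coeffMap, h, toPoly_snoc_coeffMap]

lemma esymm_rootFamily_succ (v : RootCoords r s) (i : Fin (r + 2 * s)) :
    (rootFamily v).esymm (i + 1) = ((-1) ^ (i + 1 : ℕ) * coeffMap v i.rev : ℝ) := by
  have h := Multiset.prod_X_sub_C_coeff (rootFamily v) (k := i.rev)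
    (by rw [card_rootFamily]; exact i.rev.2.le)
  have hi : r + 2 * s - (i.rev : ℕ) = i + 1 := by
    rw [Fin.val_rev]
    lia
  rw [card_rootFamily, ← map_rootPoly_eq_prod_rootFamily, coeff_map, hi] at h
  rw [Complex.ofReal_mul, coeffMap, ← Complex.coe_algebraMap, h, ← mul_assoc]
  simp [← mul_pow]

end RootsAndCoefficients

section SignatureSet

/-- The vectors `(q_0, …, q_{d-1})` for which `X^d + q_{d-1} X^{d-1} + ⋯ + q_0` has signature `s`;
this is `𝓗_d^*(s, B)` without the bound on the coefficients. -/
def signatureSet (d s : ℕ) : Set (Fin d → ℝ) :=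
  {q | HasSignature (toPoly (Fin.snoc q 1 : Fin (d + 1) → ℝ)) s}

/-- The root coordinates with all `z_j` nonzero; this is `H_d(s, B)` without the bound on the
elementary symmetric functions. -/
def nonrealPairs (r s : ℕ) : Set (RootCoords r s) := {v | ∀ j, v.2.2 j ≠ 0}

variable {r s : ℕ}

lemma preimage_coeffMap_signatureSet :
    coeffMap ⁻¹' signatureSet (r + 2 * s) s = nonrealPairs r s := by
  ext v
  have hcard : Multiset.card ((rootFamily v).filter fun w => w.im ≠ 0) =
      2 * (Finset.univ.filter fun j => v.2.2 j ≠ 0).card := by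
    simp only [rootFamily_eq_add, Multiset.filter_add, Multiset.filter_map, Multiset.card_add,
      Multiset.card_map, Function.comp_def, Complex.ofReal_im, Complex.conj_im, upperRoot, ne_eq,
      neg_eq_zero, not_true_eq_false, Multiset.filter_false, Multiset.card_zero, zero_add, two_mul]
    rfl
  have hall : (Finset.univ.filter fun j => v.2.2 j ≠ 0).card = s ↔ ∀ j, v.2.2 j ≠ 0 := by
    simpa using Finset.card_filter_eq_iff (s := Finset.univ) (p := fun j => v.2.2 j ≠ 0)
  rw [Set.mem_preimage, signatureSet, Set.mem_ofPred_eq, toPoly_snoc_coeffMap, HasSignature,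
    aroots_rootPoly, hcard, Nat.mul_right_inj two_ne_zero, hall]
  rfl

lemma signatureSet_subset_range_coeffMap :
    signatureSet (r + 2 * s) s ⊆ Set.range (coeffMap : RootCoords r s → _) := by
  intro q hq
  set P := toPoly (Fin.snoc q 1 : Fin (r + 2 * s + 1) → ℝ)
  have hcard : Multiset.card (P.aroots ℂ) = r + 2 * s := by
    rw [IsAlgClosed.card_aroots_eq_natDegree, natDegree_toPoly_snoc_one]
  obtain ⟨v, hv⟩ := exists_rootFamily_eq hcard (aroots_map_conj P) hq
  have hP : rootPoly v = P := eq_of_aroots_eq (monic_rootPoly v) (monic_toPoly_snoc_one q) <| by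
    rw [aroots_rootPoly, hv]
  refine ⟨v, funext fun i => ?_⟩
  rw [coeffMap, hP, coeff_toPoly_snoc_castSucc]

lemma signatureSet_eq_empty {d : ℕ} (h : d < 2 * s) : signatureSet d s = ∅ := by
  refine Set.eq_empty_of_forall_notMem fun q hq => h.not_ge ?_
  calc 2 * s = _ := (show HasSignature _ s from hq).symm
    _ ≤ _ := Multiset.card_le_card (Multiset.filter_le _ _)
    _ ≤ _ := card_roots' _
    _ ≤ d := natDegree_map_le.trans (natDegree_toPoly_le _)

lemma coeffSetMonic_eq_inter {d : ℕ} {B : ℝ} (hB : 1 ≤ B) :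
    coeffSetMonic d s B = signatureSet d s ∩ {q | ∀ i, |q i| ≤ B} := by
  ext q
  simp [coeffSetMonic, coeffSet, signatureSet, Fin.forall_fin_succ', hB, and_comm]

lemma preimage_coeffMap_coeffSetMonic {B : ℝ} (hB : 1 ≤ B) :
    coeffMap ⁻¹' coeffSetMonic (r + 2 * s) s B = rootSet r s B := by
  ext v
  have hIcc {p : ℕ → Prop} : (∀ j ∈ Finset.Icc 1 (r + 2 * s), p j) ↔
      ∀ i : Fin (r + 2 * s), p (i + 1) := by
    refine ⟨fun h i => h _ (Finset.mem_Icc.mpr ⟨by lia, i.2⟩), fun h j hj => ?_⟩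
    obtain ⟨h1, h2⟩ := Finset.mem_Icc.mp hj
    simpa [Nat.sub_add_cancel h1] using h ⟨j - 1, by lia⟩
  have hesymm (i : Fin (r + 2 * s)) :
      (∃ c : ℝ, -B ≤ c ∧ c ≤ B ∧ (rootFamily v).esymm (i + 1) = (c : ℂ)) ↔
        |coeffMap v i.rev| ≤ B := by
    simp [esymm_rootFamily_succ, -Complex.ofReal_mul, -Complex.ofReal_pow, ← and_assoc, ← abs_le,
      abs_mul]
  rw [coeffSetMonic_eq_inter hB, Set.preimage_inter, preimage_coeffMap_signatureSet]
  simp only [rootSet, hIcc, hesymm, Set.mem_ofPred_eq]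
  rw [← Fin.rev_surjective.forall (p := fun i => |coeffMap v i| ≤ B), and_comm]
  rfl

end SignatureSet

section Smoothness

variable {𝕜 E A : Type*} [NontriviallyNormedField 𝕜] [NormedAddCommGroup E] [NormedSpace 𝕜 E]
  [NormedCommRing A] [NormedAlgebra 𝕜 A] {N : WithTop ℕ∞}

lemma contDiff_coeff_mul {P Q : E → A[X]} (hP : ∀ n, ContDiff 𝕜 N fun v => (P v).coeff n)
    (hQ : ∀ n, ContDiff 𝕜 N fun v => (Q v).coeff n) (n : ℕ) :
    ContDiff 𝕜 N fun v => (P v * Q v).coeff n := by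
  simp only [coeff_mul]
  exact ContDiff.sum fun k _ => (hP k.1).mul (hQ k.2)

lemma contDiff_coeff_prod {ι : Type*} {P : ι → E → A[X]} (t : Finset ι)
    (hP : ∀ i n, ContDiff 𝕜 N fun v => (P i v).coeff n) (n : ℕ) :
    ContDiff 𝕜 N fun v => (∏ i ∈ t, P i v).coeff n := by
  classical
  induction t using Finset.induction_on generalizing n with
  | empty => simpa only [Finset.prod_empty] using contDiff_const
  | insert i t hi ih =>
    simp only [Finset.prod_insert hi]
    exact contDiff_coeff_mul (hP i) ih n

lemma contDiff_coeffMap (r s : ℕ) : ContDiff ℝ N (coeffMap : RootCoords r s → _) := by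
  refine contDiff_pi.mpr fun i => contDiff_coeff_mul ?_ ?_ i
  · refine contDiff_coeff_prod _ fun j n => ?_
    simp only [coeff_sub, coeff_C]
    split_ifs <;> fun_prop
  · refine contDiff_coeff_prod _ fun j n => ?_
    simp only [quadFactor, coeff_add, coeff_sub, coeff_C_mul, coeff_C]
    split_ifs <;> fun_prop

lemma continuous_coeffMap (r s : ℕ) : Continuous (coeffMap : RootCoords r s → _) :=
  (contDiff_coeffMap r s).continuous (n := 0)

end Smoothness

section Measurability

lemma measurableSet_image_of_isOpen {E F : Type*} [PseudoEMetricSpace E] [SigmaCompactSpace E]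
    [TopologicalSpace F] [T2Space F] [MeasurableSpace F] [OpensMeasurableSpace F]
    {f : E → F} (hf : Continuous f) {U : Set E} (hU : IsOpen U) : MeasurableSet (f '' U) := by
  obtain ⟨C, hC, -, rfl, -⟩ := hU.exists_iUnion_isClosed
  have h (n : ℕ) : IsSigmaCompact (f '' C n) :=
    (isSigmaCompact_univ.of_isClosed_subset (hC n) (Set.subset_univ _)).image hf
  obtain ⟨K, hK, hKC⟩ := isSigmaCompact_iUnion _ h
  rw [Set.image_iUnion, ← hKC]
  exact MeasurableSet.iUnion fun n => (hK n).measurableSet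

lemma isOpen_nonrealPairs (r s : ℕ) : IsOpen (nonrealPairs r s) := by
  simp only [nonrealPairs, Set.ofPred_forall]
  exact isOpen_iInter_of_finite fun j => isOpen_ne_fun (by fun_prop) continuous_const

lemma measurableSet_signatureSet (d s : ℕ) : MeasurableSet (signatureSet d s) := by
  rcases lt_or_ge d (2 * s) with h | h
  · rw [signatureSet_eq_empty h]
    exact MeasurableSet.empty
  · obtain ⟨r, rfl⟩ := Nat.exists_eq_add_of_le' h
    rw [← Set.image_preimage_eq_of_subset signatureSet_subset_range_coeffMap,
      preimage_coeffMap_signatureSet]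
    exact measurableSet_image_of_isOpen (continuous_coeffMap r s) (isOpen_nonrealPairs r s)

lemma setOf_abs_le_eq_Icc {ι : Type*} (B : ℝ) :
    {p : ι → ℝ | ∀ i, |p i| ≤ B} = Set.Icc (fun _ => -B) fun _ => B := by
  ext p
  simp only [abs_le, forall_and, Set.mem_Icc, Pi.le_def, Set.mem_ofPred_eq]

lemma measurableSet_coeffSetMonic (d s : ℕ) {B : ℝ} (hB : 1 ≤ B) :
    MeasurableSet (coeffSetMonic d s B) := by
  rw [coeffSetMonic_eq_inter hB, setOf_abs_le_eq_Icc]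
  exact (measurableSet_signatureSet d s).inter measurableSet_Icc

lemma hasSignature_toPoly_smul_iff {d s : ℕ} {t : ℝ} (ht : t ≠ 0) (p : Fin (d + 1) → ℝ) :
    HasSignature (toPoly (t • p)) s ↔ HasSignature (toPoly p) s := by
  rw [HasSignature, HasSignature, toPoly_smul, aroots_C_mul _ ht]

lemma snoc_eq_smul_snoc_one {d : ℕ} {t : ℝ} (ht : t ≠ 0) (q : Fin d → ℝ) :
    (Fin.snoc q t : Fin (d + 1) → ℝ) = t • (Fin.snoc (t⁻¹ • q) 1 : Fin (d + 1) → ℝ) := by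
  ext i
  refine Fin.lastCases ?_ (fun j => ?_) i <;> simp [ht]

lemma hasSignature_toPoly_snoc_iff {d s : ℕ} {t : ℝ} (ht : t ≠ 0) (q : Fin d → ℝ) :
    HasSignature (toPoly (Fin.snoc q t : Fin (d + 1) → ℝ)) s ↔ t⁻¹ • q ∈ signatureSet d s := by
  rw [snoc_eq_smul_snoc_one ht, hasSignature_toPoly_smul_iff ht]
  rfl

lemma measurableSet_coeffSetPos (d s : ℕ) (B : ℝ) : MeasurableSet (coeffSetPos d s B) := by
  have h : coeffSetPos d s B = {p | 0 < p (Fin.last d)} ∩ {p | ∀ i, |p i| ≤ B} ∩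
      (fun p => (p (Fin.last d))⁻¹ • Fin.init p) ⁻¹' signatureSet d s := by
    ext p
    have hsig (hp : 0 < p (Fin.last d)) :=
      hasSignature_toPoly_snoc_iff (s := s) hp.ne' (Fin.init p)
    rw [Fin.snoc_init_self] at hsig
    simp only [coeffSetPos, coeffSet, Set.mem_inter_iff, Set.mem_ofPred_eq, Set.mem_preimage]
    grind
  have hinit : Measurable fun p : Fin (d + 1) → ℝ => (p (Fin.last d))⁻¹ • Fin.init p :=
    ((measurable_pi_apply _).inv).smul (measurable_pi_lambda _ fun i => measurable_pi_apply _)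
  rw [h, setOf_abs_le_eq_Icc]
  exact ((measurableSet_lt measurable_const (measurable_pi_apply _)).inter measurableSet_Icc).inter
    (hinit (measurableSet_signatureSet d s))

end Measurability

section Jacobian

lemma sum_fderiv_coeff_mul_pow_root {E ι : Type*} [NormedAddCommGroup E] [NormedSpace ℝ E]
    [Fintype ι] [DecidableEq ι] {n : ℕ} {c : E → Fin n → ℝ} {w : E → ι → ℂ}
    {c' : E →L[ℝ] (Fin n → ℝ)} {w' : E →L[ℝ] (ι → ℂ)} {u : E}
    (hc : HasFDerivAt c c' u) (hw : HasFDerivAt w w' u)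
    (h : ∀ v t, (∑ k, (c v k : ℂ) * t ^ (k : ℕ)) + t ^ n = ∏ j, (t - w v j)) (e : E) (i : ι) :
    ∑ k, (c' e k : ℂ) * w u i ^ (k : ℕ) = -(∏ j ∈ {i}ᶜ, (w u i - w u j)) * w' e i := by
  set t := w u i
  have hsum : HasFDerivAt (fun v => (∑ k, (c v k : ℂ) * t ^ (k : ℕ)) + t ^ n)
      (∑ k : Fin n, t ^ (k : ℕ) • Complex.ofRealCLM.comp
        ((ContinuousLinearMap.proj k).comp c')) u :=
    .add_const _ <| .fun_sum fun k _ => .mul_const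
      (Complex.ofRealCLM.hasFDerivAt.comp u (hasFDerivAt_pi'.mp hc k)) _
  have hprod : HasFDerivAt (fun v => ∏ j, (t - w v j))
      (∑ k, (∏ j ∈ Finset.univ.erase k, (t - w u j)) •
        -((ContinuousLinearMap.proj k).comp w')) u :=
    .finsetProd fun k _ => (hasFDerivAt_pi'.mp hw k).const_sub t
  -- At `t = w u i` every summand of the product rule with `k ≠ i` contains the factor `t - w u i`.
  have hvanish (k : ι) (hk : k ≠ i) : ∏ j ∈ Finset.univ.erase k, (t - w u j) = 0 :=
    Finset.prod_eq_zero (Finset.mem_erase.mpr ⟨hk.symm, Finset.mem_univ i⟩) (sub_self t)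
  simp only [h] at hsum
  have heq := DFunLike.congr_fun (hsum.unique hprod) e
  rw [sum_apply, sum_apply, Finset.sum_eq_single i (fun k _ hk => by simp [hvanish k hk]) (by simp),
    ← Finset.compl_singleton] at heq
  simpa [mul_comm] using heq

lemma abs_det_fderiv_coeff {n : ℕ} {c : (Fin n → ℝ) → Fin n → ℝ} {w : (Fin n → ℝ) → Fin n → ℂ}
    {c' : (Fin n → ℝ) →L[ℝ] (Fin n → ℝ)} {w' : (Fin n → ℝ) →L[ℝ] (Fin n → ℂ)} {u : Fin n → ℝ}
    (hc : HasFDerivAt c c' u) (hw : HasFDerivAt w w' u)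
    (h : ∀ v t, (∑ k, (c v k : ℂ) * t ^ (k : ℕ)) + t ^ n = ∏ j, (t - w v j))
    (hinj : Function.Injective (w u)) :
    |c'.det| =
      √(absDiscr (w u)) * ‖(Matrix.of fun i l => w' (Pi.single l 1) i).det‖ := by
  have hmul : Matrix.vandermonde (w u) *
      (LinearMap.toMatrix' (c' : (Fin n → ℝ) →ₗ[ℝ] _)).map (algebraMap ℝ ℂ) =
      Matrix.diagonal (fun i => -∏ j ∈ {i}ᶜ, (w u i - w u j)) *
        Matrix.of fun i l => w' (Pi.single l 1) i := by
    ext i l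
    rw [Matrix.mul_apply, Matrix.diagonal_mul, Matrix.of_apply,
      ← sum_fderiv_coeff_mul_pow_root hc hw h]
    simp [Matrix.vandermonde, LinearMap.toMatrix'_apply, mul_comm]
  have hdet : ‖(LinearMap.toMatrix' (c' : (Fin n → ℝ) →ₗ[ℝ] _)).map (algebraMap ℝ ℂ)|>.det‖ =
      |c'.det| := by
    rw [← RingHom.mapMatrix_apply, ← RingHom.map_det, LinearMap.det_toMatrix',
      Complex.coe_algebraMap, Complex.norm_real, Real.norm_eq_abs]
  have hdiag : ‖(Matrix.diagonal fun i => -∏ j ∈ {i}ᶜ, (w u i - w u j)).det‖ =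
      √(absDiscr (w u)) * √(absDiscr (w u)) := by
    rw [Real.mul_self_sqrt (absDiscr_pos hinj).le]
    simp only [Matrix.det_diagonal, norm_prod, norm_neg, absDiscr]
  have hnorm := congrArg (fun A => ‖Matrix.det A‖) hmul
  simp only [Matrix.det_mul, norm_mul] at hnorm
  rw [norm_det_vandermonde, hdet, hdiag, mul_assoc] at hnorm
  exact mul_left_cancel₀ (Real.sqrt_pos.mpr (absDiscr_pos hinj)).ne' hnorm

end Jacobian

section Coordinates

lemma measurePreserving_comp_equiv {ι κ : Type*} [Fintype ι] [Fintype κ] (e : ι ≃ κ) :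
    MeasurePreserving (fun (x : κ → ℝ) (i : ι) => x (e i)) :=
  volume_preserving_arrowCongr' e.symm (MeasurableEquiv.refl ℝ) (MeasurePreserving.id _)

variable (r s : ℕ)

/-- An arbitrary numbering of the roots, which identifies root coordinates with vectors. -/
def idxEquiv : RootIdx r s ≃ Fin (r + 2 * s) :=
  Fintype.equivFinOfCardEq (by simp; ring)

/-- The root coordinates listed as a vector of `ℝ^(r + 2 s)`. -/
def rootCoordsEquiv : (Fin (r + 2 * s) → ℝ) ≃L[ℝ] RootCoords r s :=
  (LinearEquiv.funCongrLeft ℝ ℝ (idxEquiv r s)).toContinuousLinearEquiv.trans <|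
    (ContinuousLinearEquiv.sumPiEquivProdPi ℝ _ _ fun _ => ℝ).trans <|
      (ContinuousLinearEquiv.refl ℝ _).prodCongr
        (ContinuousLinearEquiv.sumPiEquivProdPi ℝ _ _ fun _ => ℝ)

lemma measurePreserving_rootCoordsEquiv : MeasurePreserving (rootCoordsEquiv r s) :=
  ((MeasurePreserving.id volume).prod
    (volume_measurePreserving_sumPiEquivProdPi fun _ : Fin s ⊕ Fin s => ℝ)).comp <|
    (volume_measurePreserving_sumPiEquivProdPi fun _ : RootIdx r s => ℝ).comp
      (measurePreserving_comp_equiv (idxEquiv r s))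

lemma differentiable_coeffMap_comp_rootCoordsEquiv :
    Differentiable ℝ (coeffMap ∘ rootCoordsEquiv r s) :=
  ((contDiff_coeffMap r s).comp (rootCoordsEquiv r s).contDiff).differentiable one_ne_zero

/-- The matrix of the roots `x`, `y + i z`, `y - i z` as linear functions of `x`, `y`, `z`. -/
def rootMatrix : Matrix (RootIdx r s) (RootIdx r s) ℂ :=
  Matrix.fromBlocks 1 0 0 (Matrix.fromBlocks 1 (Complex.I • 1) 1 (-(Complex.I • 1)))

lemma norm_det_rootMatrix : ‖(rootMatrix r s).det‖ = 2 ^ s := by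
  rw [rootMatrix, Matrix.det_fromBlocks_one₁₁, Matrix.zero_mul, sub_zero,
    Matrix.det_fromBlocks_one₁₁, Matrix.one_mul, ← neg_add', ← two_smul ℂ, smul_smul, ← neg_smul,
    Matrix.det_smul]
  simp

variable {r s}

lemma rootVec_rootCoordsEquiv_single (k l : RootIdx r s) :
    rootVec (rootCoordsEquiv r s (Pi.single (idxEquiv r s l) 1)) k = rootMatrix r s k l := by
  have h (m : RootIdx r s) :
      (Pi.single (idxEquiv r s l) 1 : Fin (r + 2 * s) → ℝ) (idxEquiv r s m) =
        Pi.single (M := fun _ => ℝ) l 1 m := by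
    simp [Pi.single_apply]
  have happly (u : Fin (r + 2 * s) → ℝ) : rootCoordsEquiv r s u =
      (fun j => u (idxEquiv r s (.inl j)), fun j => u (idxEquiv r s (.inr (.inl j))),
        fun j => u (idxEquiv r s (.inr (.inr j)))) := rfl
  simp only [happly, h]
  rcases k with k | k | k <;> rcases l with l | l | l <;>
    simp [rootMatrix, rootVec, upperRoot, Matrix.one_apply, Pi.single_apply, Complex.ext_iff,
      apply_ite Complex.re, apply_ite Complex.im]

lemma sum_coeffMap_mul_pow_add (v : RootCoords r s) (t : ℂ) :
    (∑ k, (coeffMap v k : ℂ) * t ^ (k : ℕ)) + t ^ (r + 2 * s) = ∏ j, (t - rootVec v j) := by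
  have heval := congrArg (eval t) (map_rootPoly v)
  have hlead := (monic_rootPoly v).coeff_natDegree
  rw [natDegree_rootPoly] at hlead
  rw [eval_eq_sum_range, natDegree_map, natDegree_rootPoly, Finset.sum_range_succ,
    Finset.sum_range, eval_prod] at heval
  simpa [hlead, coeffMap] using heval

lemma abs_det_fderiv_coeffMap_comp_rootCoordsEquiv {u : Fin (r + 2 * s) → ℝ}
    (hinj : Function.Injective (rootVec (rootCoordsEquiv r s u))) :
    |(fderiv ℝ (coeffMap ∘ rootCoordsEquiv r s) u).det| =
      4 ^ s * rootWeight (rootCoordsEquiv r s u) := by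
  let e := idxEquiv r s
  let w : (Fin (r + 2 * s) → ℝ) →L[ℝ] (Fin (r + 2 * s) → ℂ) :=
    ((LinearEquiv.funCongrLeft ℝ ℂ e.symm).toContinuousLinearEquiv :
        (RootIdx r s → ℂ) →L[ℝ] _) ∘L rootVecCLM r s ∘L (rootCoordsEquiv r s : _ →L[ℝ] _)
  have hw (v : Fin (r + 2 * s) → ℝ) : w v = rootVec (rootCoordsEquiv r s v) ∘ e.symm := rfl
  have hc := differentiable_coeffMap_comp_rootCoordsEquiv r s u
  have hroots (v : Fin (r + 2 * s) → ℝ) (t : ℂ) :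
      (∑ k, (coeffMap (rootCoordsEquiv r s v) k : ℂ) * t ^ (k : ℕ)) + t ^ (r + 2 * s) =
        ∏ j, (t - w v j) := by
    rw [sum_coeffMap_mul_pow_add, hw]
    exact (e.symm.prod_comp fun k => t - rootVec (rootCoordsEquiv r s v) k).symm
  have hmatrix : (Matrix.of fun i l => w (Pi.single l 1) i) =
      (rootMatrix r s).submatrix e.symm e.symm := by
    ext i l
    rw [Matrix.submatrix_apply, ← rootVec_rootCoordsEquiv_single, e.apply_symm_apply]
    rfl
  rw [abs_det_fderiv_coeff hc.hasFDerivAt w.hasFDerivAt hroots (hinj.comp e.symm.injective), hw,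
    absDiscr_comp_equiv, sqrt_absDiscr_rootVec, hmatrix, Matrix.det_submatrix_equiv_self,
    norm_det_rootMatrix, mul_right_comm, ← mul_pow]
  norm_num

end Coordinates

section RootSymmetry

lemma absDiscr_eq_prod_map {𝕜 ι : Type*} [NormedField 𝕜] [DecidableEq 𝕜] [Fintype ι]
    [DecidableEq ι] (w : ι → 𝕜) {m : Multiset 𝕜} (hm : Finset.univ.val.map w = m) :
    absDiscr w = (m.map fun a => ((m.erase a).map fun b => ‖a - b‖).prod).prod := by
  subst hm
  rw [absDiscr, Finset.prod_eq_multiset_prod, Multiset.map_map]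
  refine congrArg _ (Multiset.map_congr rfl fun i _ => ?_)
  rw [Function.comp_apply, ← Multiset.map_erase_of_mem _ _ (Finset.mem_univ_val i),
    Multiset.map_map, Finset.prod_eq_multiset_prod, ← Finset.erase_val,
    Finset.compl_singleton]
  rfl

variable {r s : ℕ}

lemma rootWeight_eq_of_coeffMap_eq {v w : RootCoords r s} (h : coeffMap v = coeffMap w) :
    rootWeight v = rootWeight w := by
  have hdiscr : absDiscr (rootVec v) = absDiscr (rootVec w) := by
    rw [absDiscr_eq_prod_map _ (rootFamily_eq_map v).symm, rootFamily_eq_of_coeffMap_eq h,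
      ← absDiscr_eq_prod_map _ (rootFamily_eq_map w).symm]
  have h2 : (2 : ℝ) ^ s * rootWeight v = 2 ^ s * rootWeight w := by
    rw [← sqrt_absDiscr_rootVec, hdiscr, sqrt_absDiscr_rootVec]
  exact mul_left_cancel₀ (by positivity) h2

variable (r s) in
/-- The permutations of the real roots and of the conjugate pairs, together with a choice of
signs for the imaginary parts. -/
abbrev RootSymm : Type := Equiv.Perm (Fin r) × Equiv.Perm (Fin s) × (Fin s → ℤˣ)

/-- The action of a symmetry on root coordinates; the signs are applied after the permutations. -/
def rootAct (g : RootSymm r s) (v : RootCoords r s) : RootCoords r s :=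
  (fun j => v.1 (g.1 j), fun j => v.2.1 (g.2.1 j), fun j => g.2.2 j • v.2.2 (g.2.1 j))

lemma card_rootSymm : Fintype.card (RootSymm r s) = r.factorial * (s.factorial * 2 ^ s) := by
  simp [Fintype.card_perm]

lemma measurePreserving_rootAct (g : RootSymm r s) : MeasurePreserving (rootAct g) := by
  have hsign (ε : ℤˣ) : MeasurePreserving fun t : ℝ => ε • t := by
    rcases Int.units_eq_one_or ε with rfl | rfl
    · simpa using! MeasurePreserving.id (volume : Measure ℝ)
    · simpa using Measure.measurePreserving_neg (volume : Measure ℝ)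
  exact (measurePreserving_comp_equiv g.1).prod <| (measurePreserving_comp_equiv g.2.1).prod <|
    (volume_preserving_pi fun j => hsign (g.2.2 j)).comp (measurePreserving_comp_equiv g.2.1)

lemma rootPoly_rootAct (g : RootSymm r s) (v : RootCoords r s) :
    rootPoly (rootAct g v) = rootPoly v := by
  have heven (y z : ℝ) (ε : ℤˣ) : quadFactor y (ε • z) = quadFactor y z := by
    rcases Int.units_eq_one_or ε with rfl | rfl <;> simp [quadFactor]
  simp only [rootPoly, rootAct, heven]
  exact congrArg₂ _ (Equiv.prod_comp g.1 fun j => X - C (v.1 j))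
    (Equiv.prod_comp g.2.1 fun j => quadFactor (v.2.1 j) (v.2.2 j))

lemma coeffMap_rootAct (g : RootSymm r s) (v : RootCoords r s) :
    coeffMap (rootAct g v) = coeffMap v := by
  ext i
  rw [coeffMap, coeffMap, rootPoly_rootAct]

end RootSymmetry

section OrderedRoots

/-- The root coordinates with increasing `x`, increasing `y` and positive `z`: a fundamental domain
for the symmetries of the root coordinates, up to a null set. -/
def orderedRoots (r s : ℕ) : Set (RootCoords r s) :=
  {v | StrictMono v.1 ∧ StrictMono v.2.1 ∧ ∀ j, 0 < v.2.2 j}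

lemma measurableSet_setOf_strictMono (n : ℕ) :
    MeasurableSet {x : Fin n → ℝ | StrictMono x} := by
  simp only [StrictMono, Set.ofPred_forall]
  exact .iInter fun i => .iInter fun j => .iInter fun _ => measurableSet_lt (by fun_prop)
    (by fun_prop)

lemma measurableSet_orderedRoots (r s : ℕ) : MeasurableSet (orderedRoots r s) := by
  have hpos : MeasurableSet {z : Fin s → ℝ | ∀ j, 0 < z j} := by
    simp only [Set.ofPred_forall]
    exact .iInter fun j => measurableSet_lt (by fun_prop) (by fun_prop)
  exact (measurableSet_setOf_strictMono r).prod <| (measurableSet_setOf_strictMono s).prod hpos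

lemma existsUnique_perm_strictMono_comp {α : Type*} [LinearOrder α] {n : ℕ} {x : Fin n → α}
    (hx : Function.Injective x) : ∃! σ : Equiv.Perm (Fin n), StrictMono (x ∘ σ) := by
  refine ⟨Tuple.sort x, (Tuple.monotone_sort x).strictMono_of_injective
    (hx.comp (Equiv.injective _)), fun σ hσ => Equiv.ext fun j => hx ?_⟩
  exact congrFun (Tuple.unique_monotone hσ.monotone (Tuple.monotone_sort x)) j

lemma existsUnique_units_smul_pos {ι : Type*} {z : ι → ℝ} (hz : ∀ j, z j ≠ 0) :
    ∃! ε : ι → ℤˣ, ∀ j, 0 < ε j • z j := by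
  have h (t : ℝ) (ht : t ≠ 0) : ∃! ε : ℤˣ, 0 < ε • t := by
    rcases ht.lt_or_gt with ht | ht
    · refine ⟨-1, by simpa using ht, fun ε hε => ?_⟩
      rcases Int.units_eq_one_or ε with rfl | rfl
      · exact absurd ht (by simpa using hε.le)
      · rfl
    · refine ⟨1, by simpa using ht, fun ε hε => ?_⟩
      rcases Int.units_eq_one_or ε with rfl | rfl
      · rfl
      · exact absurd ht (by simpa using hε.le)
  choose ε hε huniq using fun j => h (z j) (hz j)
  exact ⟨ε, hε, fun ε' hε' => funext fun j => huniq j _ (hε' j)⟩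

variable {r s : ℕ}

lemma existsUnique_rootAct_mem_orderedRoots {v : RootCoords r s} (hx : Function.Injective v.1)
    (hy : Function.Injective v.2.1) (hz : ∀ j, v.2.2 j ≠ 0) :
    ∃! g : RootSymm r s, rootAct g v ∈ orderedRoots r s := by
  obtain ⟨σ, hσ, hσ_uniq⟩ := existsUnique_perm_strictMono_comp hx
  obtain ⟨τ, hτ, hτ_uniq⟩ := existsUnique_perm_strictMono_comp hy
  obtain ⟨ε, hε, hε_uniq⟩ := existsUnique_units_smul_pos fun j => hz (τ j)
  refine ⟨(σ, τ, ε), ⟨hσ, hτ, hε⟩, ?_⟩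
  rintro ⟨σ', τ', ε'⟩ ⟨hσ', hτ', hε'⟩
  obtain rfl := hσ_uniq σ' hσ'
  obtain rfl := hτ_uniq τ' hτ'
  obtain rfl := hε_uniq ε' hε'
  rfl

lemma ae_injective (ι : Type*) [Fintype ι] : ∀ᵐ x : ι → ℝ, Function.Injective x := by
  classical
  have hne (i j : ι) (hij : i ≠ j) : ∀ᵐ x : ι → ℝ, x i ≠ x j := by
    let L : (ι → ℝ) →ₗ[ℝ] ℝ := .proj (R := ℝ) (φ := fun _ => ℝ) i - .proj j
    have hL : LinearMap.ker L ≠ ⊤ := fun h => by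
      simpa [L, hij.symm] using LinearMap.congr_fun (LinearMap.ker_eq_top.mp h) (Pi.single i 1)
    filter_upwards [measure_eq_zero_iff_ae_notMem.mp (Measure.addHaar_submodule volume _ hL)]
      with x hx
    simpa [L, sub_eq_zero] using hx
  have hall : ∀ᵐ x : ι → ℝ, ∀ i j, i ≠ j → x i ≠ x j := by
    simpa only [ae_all_iff] using hne
  filter_upwards [hall] with x hx i j
  exact not_imp_not.mp (hx i j)

lemma ae_injective_rootCoords (r s : ℕ) :
    ∀ᵐ v : RootCoords r s, Function.Injective v.1 ∧ Function.Injective v.2.1 :=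
  (Measure.quasiMeasurePreserving_fst.ae (ae_injective _)).and <|
    (Measure.quasiMeasurePreserving_fst.comp Measure.quasiMeasurePreserving_snd).ae
      (ae_injective _)

lemma lintegral_eq_card_mul_setLIntegral {α G : Type*} [MeasurableSpace α] {μ : Measure α}
    [Fintype G] {T : G → α → α} (hT : ∀ g, MeasurePreserving (T g) μ μ) {f : α → ℝ≥0∞}
    (hf : Measurable f) (hfT : ∀ g x, f (T g x) = f x) {D : Set α} (hD : MeasurableSet D)
    (huniq : ∀ᵐ x ∂μ, f x ≠ 0 → ∃! g, T g x ∈ D) :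
    ∫⁻ x, f x ∂μ = Fintype.card G * ∫⁻ x in D, f x ∂μ := by
  classical
  have hfD : Measurable (D.indicator f) := hf.indicator hD
  have hsum : f =ᵐ[μ] fun x => ∑ g, D.indicator f (T g x) := by
    filter_upwards [huniq] with x hx
    by_cases h0 : f x = 0
    · simp [Set.indicator_apply, hfT, h0]
    · obtain ⟨g, hg, hg_uniq⟩ := hx h0
      rw [Fintype.sum_eq_single g fun g' hne =>
        Set.indicator_of_notMem (fun h => hne (hg_uniq g' h)) f, Set.indicator_of_mem hg, hfT]
  calc ∫⁻ x, f x ∂μ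
    _ = ∑ g, ∫⁻ x, D.indicator f (T g x) ∂μ := by
      rw [lintegral_congr_ae hsum]
      exact lintegral_finsetSum _ fun g _ => hfD.comp (hT g).measurable
    _ = ∑ _g : G, ∫⁻ x in D, f x ∂μ := by
      simp only [(hT _).lintegral_comp hfD, lintegral_indicator hD]
    _ = Fintype.card G * ∫⁻ x in D, f x ∂μ := by
      rw [Finset.sum_const, Finset.card_univ, nsmul_eq_mul]

lemma mem_rootFamily_iff (v : RootCoords r s) (a : ℂ) :
    a ∈ rootFamily v ↔
      (∃ j, (v.1 j : ℂ) = a) ∨ (∃ j, upperRoot v j = a) ∨ ∃ j, conj (upperRoot v j) = a := by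
  simp [rootFamily_eq_add]

lemma range_fst_eq {v : RootCoords r s} (hz : ∀ j, 0 < v.2.2 j) :
    Set.range v.1 = {t : ℝ | (t : ℂ) ∈ rootFamily v} := by
  ext t
  simp [mem_rootFamily_iff, Complex.ext_iff, upperRoot, (hz _).ne']

lemma range_upperRoot_eq {v : RootCoords r s} (hz : ∀ j, 0 < v.2.2 j) :
    Set.range (upperRoot v) = {a | a ∈ rootFamily v ∧ 0 < a.im} := by
  ext a
  rw [Set.mem_ofPred_eq, mem_rootFamily_iff]
  constructor
  · rintro ⟨j, rfl⟩
    exact ⟨.inr (.inl ⟨j, rfl⟩), hz j⟩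
  · rintro ⟨⟨j, rfl⟩ | ⟨j, rfl⟩ | ⟨j, rfl⟩, h⟩
    · exact absurd h (lt_irrefl _)
    · exact ⟨j, rfl⟩
    · exact absurd (hz j) (neg_pos.mp h).not_gt

lemma eq_of_range_eq_of_strictMono_comp {ι α β : Type*} [LinearOrder ι] [WellFoundedLT ι]
    [PartialOrder β] {f g : ι → α} {φ : α → β} (hf : StrictMono (φ ∘ f))
    (hg : StrictMono (φ ∘ g)) (h : Set.range f = Set.range g) : f = g := by
  have hφ : φ ∘ f = φ ∘ g := (hf.range_inj hg).mp (by rw [Set.range_comp, h, Set.range_comp])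
  ext j
  obtain ⟨k, hk⟩ : f j ∈ Set.range g := h ▸ Set.mem_range_self j
  have hjk : j = k := hg.injective ((congrFun hφ j).symm.trans (congrArg φ hk.symm))
  rw [← hk, hjk]

lemma injOn_coeffMap (r s : ℕ) :
    Set.InjOn (coeffMap : RootCoords r s → _) (orderedRoots r s) := by
  rintro v ⟨hx, hy, hz⟩ v' ⟨hx', hy', hz'⟩ h
  have hfam := rootFamily_eq_of_coeffMap_eq h
  have hfst : v.1 = v'.1 := by
    rw [← hx.range_inj hx', range_fst_eq hz, range_fst_eq hz', hfam]
  have hupper : upperRoot v = upperRoot v' :=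
    eq_of_range_eq_of_strictMono_comp (φ := Complex.re) hy hy' <| by
      rw [range_upperRoot_eq hz, range_upperRoot_eq hz', hfam]
  exact Prod.ext hfst <| Prod.ext (funext fun j => congrArg Complex.re (congrFun hupper j))
    (funext fun j => congrArg Complex.im (congrFun hupper j))

lemma injective_rootVec {v : RootCoords r s} (hv : v ∈ orderedRoots r s) :
    Function.Injective (rootVec v) := by
  obtain ⟨hx, hy, hz⟩ := hv
  have hupper : Function.Injective (upperRoot v) := fun j k h =>
    hy.injective (congrArg Complex.re h)
  refine (Complex.ofReal_injective.comp hx.injective).sumElim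
    (hupper.sumElim ((starRingEnd ℂ).injective.comp hupper) fun j k h => ?_) ?_
  · exact ((neg_lt_zero.mpr (hz k)).trans (hz j)).ne' (congrArg Complex.im h)
  · rintro j (k | k) h
    · exact (hz k).ne (congrArg Complex.im h)
    · exact (neg_lt_zero.mpr (hz k)).ne (congrArg Complex.im h).symm

end OrderedRoots

section ChangeOfVariables

variable {r s : ℕ}

lemma image_coeffMap_eq (A : Set (RootCoords r s)) :
    coeffMap '' A = (coeffMap ∘ rootCoordsEquiv r s) '' (rootCoordsEquiv r s ⁻¹' A) := by
  rw [Set.image_comp, Set.image_preimage_eq _ (rootCoordsEquiv r s).surjective]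

lemma volume_image_coeffMap_eq_zero {A : Set (RootCoords r s)} (hA : volume A = 0) :
    volume (coeffMap '' A) = 0 := by
  rw [image_coeffMap_eq]
  refine addHaar_image_eq_zero_of_differentiableOn_of_addHaar_eq_zero _
    (differentiable_coeffMap_comp_rootCoordsEquiv r s).differentiableOn ?_
  exact (measurePreserving_rootCoordsEquiv r s).quasiMeasurePreserving.preimage_null hA

lemma volume_image_coeffMap_eq_lintegral {A : Set (RootCoords r s)} (hA : MeasurableSet A)
    (hAo : A ⊆ orderedRoots r s) :
    volume (coeffMap '' A) = 4 ^ s * ∫⁻ v in A, ENNReal.ofReal (rootWeight v) := by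
  have hw : Measurable fun v : RootCoords r s => ENNReal.ofReal (rootWeight v) :=
    (continuous_rootWeight r s).measurable.ennreal_ofReal
  have hA' : MeasurableSet (rootCoordsEquiv r s ⁻¹' A) :=
    (measurePreserving_rootCoordsEquiv r s).measurable hA
  have hinj : Set.InjOn (coeffMap ∘ rootCoordsEquiv r s) (rootCoordsEquiv r s ⁻¹' A) :=
    ((injOn_coeffMap r s).mono hAo).comp (rootCoordsEquiv r s).injective.injOn fun _ hu => hu
  have hderiv (u) (_ : u ∈ rootCoordsEquiv r s ⁻¹' A) :=
    (differentiable_coeffMap_comp_rootCoordsEquiv r s u).hasFDerivAt.hasFDerivWithinAt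
      (s := rootCoordsEquiv r s ⁻¹' A)
  calc volume (coeffMap '' A)
    _ = ∫⁻ u in rootCoordsEquiv r s ⁻¹' A,
          ENNReal.ofReal |(fderiv ℝ (coeffMap ∘ rootCoordsEquiv r s) u).det| := by
      rw [image_coeffMap_eq, lintegral_abs_det_fderiv_eq_addHaar_image volume hA' hderiv hinj]
    _ = ∫⁻ u in rootCoordsEquiv r s ⁻¹' A,
          4 ^ s * ENNReal.ofReal (rootWeight (rootCoordsEquiv r s u)) := by
      refine setLIntegral_congr_fun hA' fun u hu => ?_
      rw [abs_det_fderiv_coeffMap_comp_rootCoordsEquiv (injective_rootVec (hAo hu)),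
        ENNReal.ofReal_mul (by positivity), ENNReal.ofReal_pow (by positivity),
        ENNReal.ofReal_ofNat]
    _ = 4 ^ s * ∫⁻ v in A, ENNReal.ofReal (rootWeight v) := by
      rw [(measurePreserving_rootCoordsEquiv r s).setLIntegral_comp_preimage hA
        (hw.const_mul _), lintegral_const_mul _ hw]

lemma volume_image_coeffMap_inter_orderedRoots {T : Set (Fin (r + 2 * s) → ℝ)}
    (hT : T ⊆ signatureSet (r + 2 * s) s) :
    volume (coeffMap '' (coeffMap ⁻¹' T ∩ orderedRoots r s)) = volume T := by
  set N : Set (RootCoords r s) := {v | ¬(Function.Injective v.1 ∧ Function.Injective v.2.1)}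
  have hN : volume (coeffMap '' N) = 0 :=
    volume_image_coeffMap_eq_zero (ae_iff.mp (ae_injective_rootCoords r s))
  have hcover : T ⊆ coeffMap '' (coeffMap ⁻¹' T ∩ orderedRoots r s) ∪ coeffMap '' N := by
    intro q hq
    obtain ⟨v, rfl⟩ := signatureSet_subset_range_coeffMap (hT hq)
    by_cases hv : Function.Injective v.1 ∧ Function.Injective v.2.1
    · have hz : v ∈ nonrealPairs r s := preimage_coeffMap_signatureSet.subset (hT hq)
      obtain ⟨g, hg, -⟩ := existsUnique_rootAct_mem_orderedRoots hv.1 hv.2 hz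
      exact .inl ⟨rootAct g v, ⟨by rwa [Set.mem_preimage, coeffMap_rootAct], hg⟩,
        coeffMap_rootAct g v⟩
    · exact .inr ⟨v, hv, rfl⟩
  refine le_antisymm
    (measure_mono ((Set.image_mono Set.inter_subset_left).trans (Set.image_preimage_subset _ _))) ?_
  calc volume T
    _ ≤ volume (coeffMap '' (coeffMap ⁻¹' T ∩ orderedRoots r s)) + volume (coeffMap '' N) :=
      (measure_mono hcover).trans (measure_union_le _ _)
    _ = _ := by rw [hN, add_zero]

lemma setLIntegral_preimage_coeffMap {T : Set (Fin (r + 2 * s) → ℝ)} (hT : MeasurableSet T)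
    (hTs : T ⊆ signatureSet (r + 2 * s) s) :
    ∫⁻ v in coeffMap ⁻¹' T, ENNReal.ofReal (rootWeight v) =
      r.factorial * (s.factorial * 2 ^ s) *
        ∫⁻ v in coeffMap ⁻¹' T ∩ orderedRoots r s, ENNReal.ofReal (rootWeight v) := by
  have hpre : MeasurableSet (coeffMap (r := r) (s := s) ⁻¹' T) :=
    (continuous_coeffMap r s).measurable hT
  have hw : Measurable fun v : RootCoords r s => ENNReal.ofReal (rootWeight v) :=
    (continuous_rootWeight r s).measurable.ennreal_ofReal
  set f : RootCoords r s → ℝ≥0∞ :=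
    (coeffMap ⁻¹' T).indicator fun v => ENNReal.ofReal (rootWeight v) with hf
  have hinv (g : RootSymm r s) (v : RootCoords r s) : f (rootAct g v) = f v := by
    classical
    simp only [hf, Set.indicator_apply, Set.mem_preimage, coeffMap_rootAct,
      rootWeight_eq_of_coeffMap_eq (coeffMap_rootAct g v)]
  have huniq : ∀ᵐ v, f v ≠ 0 → ∃! g, rootAct g v ∈ orderedRoots r s := by
    filter_upwards [ae_injective_rootCoords r s] with v hv hne
    have hmem : v ∈ coeffMap ⁻¹' T := Set.mem_of_indicator_ne_zero hne
    have hz : v ∈ nonrealPairs r s := preimage_coeffMap_signatureSet.subset (hTs hmem)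
    exact existsUnique_rootAct_mem_orderedRoots hv.1 hv.2 hz
  rw [← lintegral_indicator hpre, lintegral_eq_card_mul_setLIntegral measurePreserving_rootAct
    (hw.indicator hpre) hinv (measurableSet_orderedRoots r s) huniq,
    setLIntegral_indicator hpre, card_rootSymm]
  push_cast
  rfl

lemma factorial_mul_volume_eq_lintegral {T : Set (Fin (r + 2 * s) → ℝ)} (hT : MeasurableSet T)
    (hTs : T ⊆ signatureSet (r + 2 * s) s) :
    r.factorial * s.factorial * volume T =
      2 ^ s * ∫⁻ v in coeffMap ⁻¹' T, ENNReal.ofReal (rootWeight v) := by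
  have hpre : MeasurableSet (coeffMap (r := r) (s := s) ⁻¹' T) :=
    (continuous_coeffMap r s).measurable hT
  have h4 : (4 : ℝ≥0∞) ^ s = 2 ^ s * 2 ^ s := by
    rw [← mul_pow]
    norm_num
  rw [← volume_image_coeffMap_inter_orderedRoots hTs, volume_image_coeffMap_eq_lintegral
    (hpre.inter (measurableSet_orderedRoots r s)) Set.inter_subset_right,
    setLIntegral_preimage_coeffMap hT hTs, h4]
  ring

lemma coeffSetMonic_subset_Icc (d s : ℕ) (B : ℝ) :
    coeffSetMonic d s B ⊆ Set.Icc (fun _ => -B) fun _ => B := by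
  rw [← setOf_abs_le_eq_Icc]
  exact fun q hq i => by simpa using hq.1 i.castSucc

lemma volume_coeffSetMonic_ne_top (d s : ℕ) (B : ℝ) : volume (coeffSetMonic d s B) ≠ ⊤ :=
  ((measure_mono (coeffSetMonic_subset_Icc d s B)).trans_lt isCompact_Icc.measure_lt_top).ne

lemma measurableSet_rootSet (r s : ℕ) {B : ℝ} (hB : 1 ≤ B) : MeasurableSet (rootSet r s B) := by
  rw [← preimage_coeffMap_coeffSetMonic hB]
  exact (continuous_coeffMap r s).measurable (measurableSet_coeffSetMonic _ s hB)

lemma factorial_mul_volume_coeffSetMonic (r s : ℕ) {B : ℝ} (hB : 1 ≤ B) :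
    r.factorial * s.factorial * volume (coeffSetMonic (r + 2 * s) s B) =
      2 ^ s * ∫⁻ v in rootSet r s B, ENNReal.ofReal (rootWeight v) := by
  rw [← preimage_coeffMap_coeffSetMonic hB]
  refine factorial_mul_volume_eq_lintegral (measurableSet_coeffSetMonic _ s hB) ?_
  rw [coeffSetMonic_eq_inter hB]
  exact Set.inter_subset_left

lemma integrableOn_rootWeight (r s : ℕ) {B : ℝ} (hB : 1 ≤ B) :
    IntegrableOn (fun v : RootCoords r s => rootWeight v) (rootSet r s B) := by
  refine ⟨(continuous_rootWeight r s).aestronglyMeasurable, ?_⟩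
  rw [hasFiniteIntegral_iff_ofReal (.of_forall rootWeight_nonneg)]
  have hlt : 2 ^ s * ∫⁻ v in rootSet r s B, ENNReal.ofReal (rootWeight v) < ⊤ := by
    rw [← factorial_mul_volume_coeffSetMonic r s hB]
    exact ENNReal.mul_lt_top (by finiteness) (volume_coeffSetMonic_ne_top _ s B).lt_top
  exact ENNReal.lt_top_of_mul_ne_top_right hlt.ne (by simp)

lemma volume_real_coeffSetMonic (r s : ℕ) {B : ℝ} (hB : 1 ≤ B) :
    volume.real (coeffSetMonic (r + 2 * s) s B) =
      2 ^ s / (r.factorial * s.factorial) * ∫ v in rootSet r s B, rootWeight v := by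
  have h := congrArg ENNReal.toReal (factorial_mul_volume_coeffSetMonic r s hB)
  simp only [ENNReal.toReal_mul, ENNReal.toReal_natCast, ENNReal.toReal_pow,
    ENNReal.toReal_ofNat] at h
  rw [integral_eq_lintegral_of_nonneg_ae (.of_forall rootWeight_nonneg)
    (continuous_rootWeight r s).aestronglyMeasurable, div_mul_eq_mul_div,
    eq_div_iff (by positivity), mul_comm]
  exact h

end ChangeOfVariables

section LeadingCoefficient

variable {d s : ℕ}

lemma measurePreserving_snoc (d : ℕ) :
    MeasurePreserving fun x : ℝ × (Fin d → ℝ) => (Fin.snoc x.2 x.1 : Fin (d + 1) → ℝ) := by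
  convert! (volume_preserving_piFinSuccAbove (fun _ : Fin (d + 1) => ℝ) (Fin.last d)).symm with x
  exact (Fin.insertNth_last' x.1 x.2).symm

lemma integrable_volume_real_slice {S : Set (Fin (d + 1) → ℝ)} (hS : MeasurableSet S)
    (hfin : volume S ≠ ⊤) :
    Integrable fun t : ℝ => volume.real {q : Fin d → ℝ | (Fin.snoc q t : Fin (d + 1) → ℝ) ∈ S} := by
  have hsnoc := measurePreserving_snoc d
  refine Measure.integrable_measure_prodMk_left (hsnoc.measurable hS) ?_
  rwa [← Measure.volume_eq_prod, hsnoc.measure_preimage hS.nullMeasurableSet]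

lemma integral_volume_real_slice {S : Set (Fin (d + 1) → ℝ)} (hS : MeasurableSet S)
    (hfin : volume S ≠ ⊤) :
    ∫ t : ℝ, volume.real {q : Fin d → ℝ | (Fin.snoc q t : Fin (d + 1) → ℝ) ∈ S} =
      volume.real S := by
  have hsnoc := measurePreserving_snoc d
  have hprod := Measure.prod_apply (μ := volume) (ν := volume) (hsnoc.measurable hS)
  rw [← Measure.volume_eq_prod, hsnoc.measure_preimage hS.nullMeasurableSet] at hprod
  have hmeas := measurable_measure_prodMk_left (ν := volume) (hsnoc.measurable hS)
  rw [Measure.real, hprod]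
  exact integral_toReal hmeas.aemeasurable (ae_lt_top hmeas (hprod ▸ hfin))

lemma coeffSetPos_subset_Icc (d s : ℕ) (B : ℝ) :
    coeffSetPos d s B ⊆ Set.Icc (fun _ => -B) fun _ => B := by
  rw [← setOf_abs_le_eq_Icc]
  exact fun p hp => hp.1.1

lemma volume_coeffSetPos_ne_top (d s : ℕ) (B : ℝ) : volume (coeffSetPos d s B) ≠ ⊤ :=
  ((measure_mono (coeffSetPos_subset_Icc d s B)).trans_lt isCompact_Icc.measure_lt_top).ne

lemma smul_mem_coeffSet_iff {B t : ℝ} (ht : 0 < t) (p : Fin (d + 1) → ℝ) :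
    t • p ∈ coeffSet d s B ↔ p ∈ coeffSet d s (B / t) := by
  simp only [coeffSet, Set.mem_ofPred_eq, hasSignature_toPoly_smul_iff ht.ne', Pi.smul_apply,
    smul_eq_mul, abs_mul, abs_of_pos ht, le_div_iff₀' ht]

lemma coeffSetPos_eq_smul {B : ℝ} (hB : 0 < B) : coeffSetPos d s B = B • coeffSetPos d s 1 := by
  ext p
  obtain ⟨p, rfl⟩ : ∃ p', B • p' = p := ⟨B⁻¹ • p, smul_inv_smul₀ hB.ne' p⟩
  rw [Set.smul_mem_smul_set_iff₀ hB.ne', coeffSetPos, coeffSetPos, Set.mem_ofPred_eq,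
    Set.mem_ofPred_eq, smul_mem_coeffSet_iff hB, div_self hB.ne', Pi.smul_apply,
    smul_pos_iff_of_pos_left hB]

lemma volume_real_smul {n : ℕ} {t : ℝ} (ht : 0 < t) (S : Set (Fin n → ℝ)) :
    volume.real (t • S) = t ^ n * volume.real S := by
  rw [Measure.real, Measure.addHaar_smul, Module.finrank_fin_fun, ENNReal.toReal_mul,
    ENNReal.toReal_ofReal (abs_nonneg _), abs_of_pos (pow_pos ht n), Measure.real]

lemma volume_real_coeffSetPos_eq_pow_mul {B : ℝ} (hB : 0 < B) :
    volume.real (coeffSetPos d s B) = B ^ (d + 1) * volume.real (coeffSetPos d s 1) := by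
  rw [coeffSetPos_eq_smul hB, volume_real_smul hB]

lemma slice_coeffSetPos_one_eq_smul {u : ℝ} (hu : 0 < u) :
    {q : Fin d → ℝ | (Fin.snoc q u : Fin (d + 1) → ℝ) ∈ coeffSetPos d s 1} =
      u • coeffSetMonic d s (1 / u) := by
  ext q
  have hlast : 0 < (Fin.snoc q u : Fin (d + 1) → ℝ) (Fin.last d) := by simpa using hu
  rw [Set.mem_smul_set_iff_inv_smul_mem₀ hu.ne', coeffSetMonic, Set.mem_ofPred_eq,
    Set.mem_ofPred_eq, coeffSetPos, Set.mem_ofPred_eq, and_iff_left hlast,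
    snoc_eq_smul_snoc_one hu.ne', smul_mem_coeffSet_iff hu]

lemma slice_coeffSetPos_one_eq_empty {u : ℝ} (hu : u ∉ Set.Ioc 0 1) :
    {q : Fin d → ℝ | (Fin.snoc q u : Fin (d + 1) → ℝ) ∈ coeffSetPos d s 1} = ∅ := by
  refine Set.eq_empty_of_forall_notMem fun q hq => hu ⟨?_, ?_⟩
  · simpa using hq.2
  · simpa using (le_abs_self _).trans (hq.1.1 (Fin.last d))

variable (d s) in
lemma volume_real_slice_coeffSetPos_one :
    (fun u : ℝ =>
      volume.real {q : Fin d → ℝ | (Fin.snoc q u : Fin (d + 1) → ℝ) ∈ coeffSetPos d s 1}) =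
      (Set.Ioc 0 1).indicator fun u => u ^ d * volume.real (coeffSetMonic d s (1 / u)) := by
  ext u
  by_cases hu : u ∈ Set.Ioc 0 1
  · rw [Set.indicator_of_mem hu, slice_coeffSetPos_one_eq_smul hu.1, volume_real_smul hu.1]
  · rw [Set.indicator_of_notMem hu, slice_coeffSetPos_one_eq_empty hu, measureReal_empty]

lemma intervalIntegrable_pow_mul_volume_real_coeffSetMonic (d s : ℕ) :
    IntervalIntegrable (fun u : ℝ => u ^ d * volume.real (coeffSetMonic d s (1 / u)))
      volume 0 1 := by
  rw [intervalIntegrable_iff_integrableOn_Ioc_of_le zero_le_one,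
    ← integrable_indicator_iff measurableSet_Ioc, ← volume_real_slice_coeffSetPos_one]
  exact integrable_volume_real_slice (measurableSet_coeffSetPos d s 1)
    (volume_coeffSetPos_ne_top d s 1)

lemma volume_real_coeffSetPos (d s : ℕ) {B : ℝ} (hB : 0 < B) :
    volume.real (coeffSetPos d s B) =
      B ^ (d + 1) * ∫ u in (0 : ℝ)..1, u ^ d * volume.real (coeffSetMonic d s (1 / u)) := by
  rw [volume_real_coeffSetPos_eq_pow_mul hB, intervalIntegral.integral_of_le zero_le_one,
    ← integral_indicator measurableSet_Ioc, ← volume_real_slice_coeffSetPos_one,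
    integral_volume_real_slice (measurableSet_coeffSetPos d s 1) (volume_coeffSetPos_ne_top d s 1)]

end LeadingCoefficient

end BoundedHeight

end

theorem theorem2 (d r s : ℕ) (hd : 0 < d) (hrs : d = r + 2 * s) :
    (∀ B : ℝ, 1 ≤ B →
      NullMeasurableSet (BoundedHeight.coeffSetMonic d s B) volume ∧
      volume (BoundedHeight.coeffSetMonic d s B) ≠ ⊤ ∧
      NullMeasurableSet (BoundedHeight.rootSet r s B) volume ∧
      IntegrableOn (fun v : BoundedHeight.RootCoords r s => BoundedHeight.rootWeight v)
        (BoundedHeight.rootSet r s B) volume ∧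
      volume.real (BoundedHeight.coeffSetMonic d s B) =
        (2 : ℝ) ^ s / ((r.factorial : ℝ) * (s.factorial : ℝ)) *
          ∫ v in BoundedHeight.rootSet r s B, BoundedHeight.rootWeight v) ∧
    (∀ B : ℝ, 0 < B →
      NullMeasurableSet (BoundedHeight.coeffSetPos d s B) volume ∧
      volume (BoundedHeight.coeffSetPos d s B) ≠ ⊤ ∧
      IntervalIntegrable
        (fun u : ℝ => u ^ d * volume.real (BoundedHeight.coeffSetMonic d s (1 / u)))
        volume 0 1 ∧
      volume.real (BoundedHeight.coeffSetPos d s B) =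
        B ^ (d + 1) *
          ∫ u in (0 : ℝ)..1,
            u ^ d * volume.real (BoundedHeight.coeffSetMonic d s (1 / u))) := by
  subst hrs
  open BoundedHeight in
  exact ⟨fun B hB =>
      ⟨(measurableSet_coeffSetMonic _ s hB).nullMeasurableSet,
        volume_coeffSetMonic_ne_top _ s B,
        (measurableSet_rootSet r s hB).nullMeasurableSet,
        integrableOn_rootWeight r s hB,
        volume_real_coeffSetMonic r s hB⟩,
    fun B hB =>
      ⟨(measurableSet_coeffSetPos _ s B).nullMeasurableSet,
        volume_coeffSetPos_ne_top _ s B,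
        intervalIntegrable_pow_mul_volume_real_coeffSetMonic _ s,
        volume_real_coeffSetPos _ s hB⟩⟩
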